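/- Let $d\ge 0$ be an integer, let $R$ be a $d\times d$ integer matrix that is expansive (all its complex eigenvalues have modulus strictly greater than $1$), and let $B\subset\mathbb Z^d$ be a nonempty finite set that is a simple digit set for $R$, that is, distinct elements of $B$ are not congruent modulo $R\mathbb Z^d$. Consider the affine iterated function system $\tau_b(x)=R^{-1}(x+b)$, $x\in\mathbb R^d$, $b\in B$. Then: (0) There is a unique nonempty compact set $T=T(R,B)\subset\mathbb R^d$ with $T=\bigcup_{b\in B}\tau_b(T)$ (the attractor), and for every family of weights $p_b>0$ ($b\in B$) with $\sum_{b\in B}p_b=1$ there is a unique Borel probability measure $\mu$ on $\mathbb R^d$ with $\mu(E)=\sum_{b\in B}p_b\,\mu(\tau_b^{-1}(E))$ for all Borel sets $E$ (the self-affine measure with weights $p_b$). (1) Open set condition: there is a nonempty open set $U\subset\mathbb R^d$ such that $\tau_b(U)\cap\tau_{b'}(U)=\emptyset$ for all $b\ne b'$ in $B$ and $\bigcup_{b\in B}\tau_b(U)\subset U$. (2) Strong open set condition: the set $U$ in (1) can be chosen such that, furthermore, $U\cap T\neq\emptyset$. (3) No-overlap condition: for every family of weights as in (0), in particular for the equal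 weights $p_b=1/\#B$, the self-affine measure $\mu$ satisfies $\mu(\tau_b(T)\cap\tau_{b'}(T))=0$ for all $b\neq b'$ in $B$. -/

import Mathlib

open scoped Matrix NNReal ENNReal
open MeasureTheory

namespace AffineIFS

/-- An integer matrix is expansive if all its (complex) eigenvalues have modulus `> 1`. -/
def Expansive {d : ℕ} (R : Matrix (Fin d) (Fin d) ℤ) : Prop :=
  ∀ z : ℂ, Module.End.HasEigenvalue (Matrix.toLin' (R.map (Int.cast : ℤ → ℂ))) z → 1 < ‖z‖

/-- `B` is a simple digit set for `R`: a nonempty finite set of integer vectors, distinct elements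
of which are incongruent modulo `R ℤ^d`. -/
def SimpleDigitSet {d : ℕ} (R : Matrix (Fin d) (Fin d) ℤ) (B : Finset (Fin d → ℤ)) : Prop :=
  B.Nonempty ∧ ∀ b ∈ B, ∀ b' ∈ B, b ≠ b' → ¬ ∃ z : Fin d → ℤ, b - b' = R *ᵥ z

/-- The affine map `τ_b(x) = R⁻¹ (x + b)` of `ℝ^d`. (An expansive `R` is invertible over `ℝ`. Only
the topology and the Borel sets of `ℝ^d` matter below, not the norm.) -/
noncomputable def tau {d : ℕ} (R : Matrix (Fin d) (Fin d) ℤ) (b : Fin d → ℤ)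
    (x : Fin d → ℝ) : Fin d → ℝ :=
  (R.map (Int.cast : ℤ → ℝ))⁻¹ *ᵥ (x + fun i => (b i : ℝ))

/-- `T` is an attractor of the IFS `{τ_b}_{b ∈ B}`: a nonempty compact set with
`T = ⋃_{b ∈ B} τ_b(T)`. -/
def IsAttractor {d : ℕ} (R : Matrix (Fin d) (Fin d) ℤ) (B : Finset (Fin d → ℤ))
    (T : Set (Fin d → ℝ)) : Prop :=
  T.Nonempty ∧ IsCompact T ∧ T = ⋃ b ∈ B, tau R b '' T

/-- The weights `p_b`, `b ∈ B`, form a probability vector with positive entries. -/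
def IsWeight {d : ℕ} (B : Finset (Fin d → ℤ)) (p : (Fin d → ℤ) → ℝ≥0) : Prop :=
  (∀ b ∈ B, 0 < p b) ∧ ∑ b ∈ B, p b = 1

/-- `μ` is a self-affine measure with weights `p`: a Borel probability measure with
`μ(E) = ∑_{b ∈ B} p_b μ(τ_b⁻¹(E))` for all Borel sets `E`. -/
def IsSelfAffineMeasure {d : ℕ} (R : Matrix (Fin d) (Fin d) ℤ) (B : Finset (Fin d → ℤ))
    (p : (Fin d → ℤ) → ℝ≥0) (μ : Measure (Fin d → ℝ)) : Prop :=
  IsProbabilityMeasure μ ∧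
    ∀ E : Set (Fin d → ℝ), MeasurableSet E → μ E = ∑ b ∈ B, (p b : ℝ≥0∞) * μ (tau R b ⁻¹' E)

/-- `U` is a nonempty open set witnessing the open set condition. -/
def IsOSCSet {d : ℕ} (R : Matrix (Fin d) (Fin d) ℤ) (B : Finset (Fin d → ℤ))
    (U : Set (Fin d → ℝ)) : Prop :=
  IsOpen U ∧ U.Nonempty ∧
    (∀ b ∈ B, ∀ b' ∈ B, b ≠ b' → tau R b '' U ∩ tau R b' '' U = ∅) ∧
    (⋃ b ∈ B, tau R b '' U) ⊆ U

/-- The open set condition. -/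
def OSC {d : ℕ} (R : Matrix (Fin d) (Fin d) ℤ) (B : Finset (Fin d → ℤ)) : Prop :=
  ∃ U : Set (Fin d → ℝ), IsOSCSet R B U

/-- The strong open set condition, `T` being the attractor. -/
def SOSC {d : ℕ} (R : Matrix (Fin d) (Fin d) ℤ) (B : Finset (Fin d → ℤ))
    (T : Set (Fin d → ℝ)) : Prop :=
  ∃ U : Set (Fin d → ℝ), IsOSCSet R B U ∧ (U ∩ T).Nonempty

/-- The no-overlap condition for the measure `μ`, `T` being the attractor. -/
def NoOverlap {d : ℕ} (R : Matrix (Fin d) (Fin d) ℤ) (B : Finset (Fin d → ℤ))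
    (T : Set (Fin d → ℝ)) (μ : Measure (Fin d → ℝ)) : Prop :=
  ∀ b ∈ B, ∀ b' ∈ B, b ≠ b' → μ (tau R b '' T ∩ tau R b' '' T) = 0

end AffineIFS

/-!
An expansive `R` has an inverse of spectral radius less than `1`, so by Gelfand's formula some power
of `R⁻¹` is a contraction for the sup norm, and `R⁻¹` itself is one for an equivalent norm
(`Expansive.exists_lipschitzWith_tau`). For contractions of a complete metric space the coding map
on infinite words is the fixed point of a contraction (`exists_codingMap`); its range is the
attractor, and the image of a product measure is the self-affine measure. Uniqueness comes from
iterating the two invariance equations, which brings invariant objects closer by the contraction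
factor at each step.

The open set condition rests on arithmetic. If `w` and `w'` are words of the same length `n`, then
`R ^ n` turns `τ_w x = τ_w' y` into `x + digitSum w = y + digitSum w'`, and for a simple digit set
the integer vector `digitSum w` determines `w` among the words of length `n`. So, when `V` is a
bounded neighbourhood of the attractor `T` mapped into itself by all `τ_b`, the pieces `τ_w' V` that
meet `τ_w V` correspond to integer vectors `digitSum w' - digitSum w` from a fixed finite set.
Choose a word `I` for which this set of vectors is maximal. Prefixing any word `K` to `I` keeps the
vectors of `I` and, by maximality, adds no new one, so that the only pieces of the same level
meeting `τ_{K I} V` are the `τ_{K J} V`, which have the same first digit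
(`exists_separating_word`). Hence `U = ⋃_K τ_{K I} V` is open, is mapped into itself by each
`τ_b`, has disjoint images under distinct `τ_b`, and contains points of `T`. This gives the strong
open set condition, and with it the open set condition.

In addition `τ_b U` is disjoint from `τ_b' T` for `b ≠ b'`, so the overlaps of `T` lie outside
`⋃_b τ_b U`. The self-affine measure of that complement vanishes: the complement `C` of `U`
satisfies `τ_b⁻¹ C ⊆ C`, invariance of `μ` forces `μ (C \ τ_w⁻¹ C) = 0` for each word `w`, and
`τ_I⁻¹ C` misses `T`, which carries `μ`.
-/

namespace AffineIFS

/-! ### Contractive iterated function systems -/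

section Contractive

open Metric Set Filter Topology

variable {ι X : Type*} {f : ι → X → X} {K : ℝ≥0}

/-- The sequence `i, ω 0, ω 1, …` obtained by putting `i` in front of `ω`. -/
def seqCons {α : Type*} (i : α) (ω : ℕ → α) : ℕ → α
  | 0 => i
  | n + 1 => ω n

theorem measurable_seqCons {α : Type*} [MeasurableSpace α] :
    Measurable fun q : α × (ℕ → α) => seqCons q.1 q.2 := by
  refine measurable_pi_lambda _ fun n => ?_
  cases n with
  | zero => exact measurable_fst
  | succ n => exact (measurable_pi_apply n).comp measurable_snd

/-- The coding map of a contractive iterated function system: `π ω` is the limit of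
`f (ω 0) (f (ω 1) (⋯ (f (ω n) x)))`. It is obtained here as the fixed point of a contraction of the
complete space of continuous functions on the compact space of sequences. -/
theorem exists_codingMap [Finite ι] [MetricSpace X] [CompleteSpace X] [Nonempty X]
    [TopologicalSpace ι] [DiscreteTopology ι] (hK : K < 1) (hf : ∀ i, LipschitzWith K (f i)) :
    ∃ π : (ℕ → ι) → X, Continuous π ∧ ∀ ω, π ω = f (ω 0) (π fun n => ω (n + 1)) := by
  have hcont : Continuous fun q : ι × X => f q.1 q.2 :=
    continuous_prod_of_discrete_left.2 fun i => (hf i).continuous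
  let Φ : C(ℕ → ι, X) → C(ℕ → ι, X) := fun π =>
    ⟨fun ω => f (ω 0) (π fun n => ω (n + 1)), by
      have hshift : Continuous fun ω : ℕ → ι => π fun n => ω (n + 1) :=
        π.continuous.comp (continuous_pi fun n => continuous_apply (n + 1))
      exact hcont.comp ((continuous_apply (0 : ℕ)).prodMk hshift)⟩
  have hΦ : ContractingWith K Φ := by
    refine ⟨hK, LipschitzWith.of_dist_le_mul fun π₁ π₂ => ?_⟩
    refine (ContinuousMap.dist_le (by positivity)).2 fun ω => ?_
    refine ((hf (ω 0)).dist_le_mul _ _).trans ?_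
    gcongr
    exact ContinuousMap.dist_apply_le_dist _
  have : Nonempty C(ℕ → ι, X) := ⟨ContinuousMap.const _ (Classical.arbitrary X)⟩
  refine ⟨hΦ.fixedPoint, ContinuousMap.continuous _, fun ω => ?_⟩
  conv_lhs => rw [← hΦ.fixedPoint_isFixedPt]
  rfl

theorem image_thickening_subset [PseudoMetricSpace X] {g : X → X} (hg : LipschitzWith K g)
    (δ : ℝ) (s : Set X) : g '' thickening δ s ⊆ cthickening (K * δ) (g '' s) := by
  rintro _ ⟨x, hx, rfl⟩
  obtain ⟨y, hy, hxy⟩ := mem_thickening_iff.1 hx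
  refine mem_cthickening_of_dist_le _ (g y) _ _ (mem_image_of_mem g hy) ?_
  exact (hg.dist_le_mul x y).trans (by gcongr)

/-- Each application of the equation `S = ⋃ i, f i '' S` brings `S` closer, by a factor `K`, to the
invariant set `T`. -/
theorem exists_dist_le_pow_of_eq_iUnion_image [PseudoMetricSpace X]
    (hf : ∀ i, LipschitzWith K (f i)) {S T : Set X} {D : ℝ} (hS : S = ⋃ i, f i '' S)
    (hT : ⋃ i, f i '' T ⊆ T) (hD : ∀ x ∈ S, ∃ y ∈ T, dist x y ≤ D) (n : ℕ) :
    ∀ x ∈ S, ∃ y ∈ T, dist x y ≤ K ^ n * D := by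
  induction n with
  | zero => simpa using hD
  | succ n ih =>
    intro x hx
    rw [hS] at hx
    obtain ⟨i, z, hz, rfl⟩ := mem_iUnion.1 hx
    obtain ⟨y, hy, hzy⟩ := ih z hz
    refine ⟨f i y, hT (mem_iUnion.2 ⟨i, mem_image_of_mem _ hy⟩), ?_⟩
    calc dist (f i z) (f i y) ≤ K * dist z y := (hf i).dist_le_mul _ _
      _ ≤ K * (K ^ n * D) := by gcongr
      _ = K ^ (n + 1) * D := by ring

theorem tendsto_pow_mul_zero (hK : K < 1) (D : ℝ) :
    Tendsto (fun n : ℕ => (K : ℝ) ^ n * D) atTop (𝓝 0) := by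
  simpa using (tendsto_pow_atTop_nhds_zero_of_lt_one K.2 (by exact_mod_cast hK)).mul_const D

/-- Uniqueness of the attractor follows by applying this in both directions. -/
theorem subset_of_eq_iUnion_image [PseudoMetricSpace X] (hK : K < 1)
    (hf : ∀ i, LipschitzWith K (f i)) {S T : Set X} (hSb : IsCompact S) (hTc : IsClosed T)
    (hTn : T.Nonempty) (hS : S = ⋃ i, f i '' S) (hT : ⋃ i, f i '' T ⊆ T) : S ⊆ T := by
  intro x hx
  obtain ⟨y₀, hy₀⟩ := hTn
  obtain ⟨D, hD⟩ := hSb.isBounded.subset_closedBall y₀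
  rw [← hTc.closure_eq, Metric.mem_closure_iff]
  intro ε hε
  obtain ⟨n, hn⟩ := ((tendsto_pow_mul_zero hK D).eventually_lt_const hε).exists
  obtain ⟨y, hy, hxy⟩ := exists_dist_le_pow_of_eq_iUnion_image hf hS hT
    (fun x hx => ⟨y₀, hy₀, hD hx⟩) n x hx
  exact ⟨y, hy, hxy.trans_lt hn⟩

theorem range_eq_iUnion_image_of_forall_eq {π : (ℕ → ι) → X}
    (hπ : ∀ ω, π ω = f (ω 0) (π fun n => ω (n + 1))) : range π = ⋃ i, f i '' range π := by
  apply Subset.antisymm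
  · rintro _ ⟨ω, rfl⟩
    rw [hπ]
    exact mem_iUnion.2 ⟨ω 0, _, mem_range_self _, rfl⟩
  · refine iUnion_subset fun i => ?_
    rintro _ ⟨_, ⟨ω, rfl⟩, rfl⟩
    exact ⟨seqCons i ω, hπ _⟩

theorem existsUnique_attractor [Finite ι] [MetricSpace X] [CompleteSpace X] [Nonempty X]
    [Nonempty ι] (hK : K < 1) (hf : ∀ i, LipschitzWith K (f i)) :
    ∃! T : Set X, T.Nonempty ∧ IsCompact T ∧ T = ⋃ i, f i '' T := by
  let _ : TopologicalSpace ι := ⊥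
  have : DiscreteTopology ι := ⟨rfl⟩
  obtain ⟨π, hπ, hπf⟩ := exists_codingMap hK hf
  have hR := range_eq_iUnion_image_of_forall_eq hπf
  refine ⟨range π, ⟨range_nonempty _, isCompact_range hπ, hR⟩, ?_⟩
  · rintro S ⟨hSn, hSc, hS⟩
    exact Subset.antisymm
      (subset_of_eq_iUnion_image hK hf hSc (isCompact_range hπ).isClosed (range_nonempty _) hS
        hR.ge)
      (subset_of_eq_iUnion_image hK hf (isCompact_range hπ) hSc.isClosed hSn hR hS.ge)

/-- The neighbourhood `V` of `T` is the set of points at distance less than `1` from `T`. -/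
theorem exists_isOpen_invariant [MetricSpace X] (hK : K < 1)
    (hf : ∀ i, LipschitzWith K (f i)) {T : Set X} (hT : ⋃ i, f i '' T ⊆ T) :
    ∃ V : Set X, IsOpen V ∧ T ⊆ V ∧ (∀ x ∈ V, ∃ t ∈ T, dist x t < 1) ∧ ∀ i, f i '' V ⊆ V := by
  refine ⟨thickening 1 T, isOpen_thickening, self_subset_thickening one_pos T,
    fun x hx => mem_thickening_iff.1 hx, fun i => ?_⟩
  refine (image_thickening_subset (hf i) 1 T).trans ?_
  refine (cthickening_subset_of_subset _ ((subset_iUnion _ i).trans hT)).trans ?_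
  exact cthickening_subset_thickening' one_pos (by simpa using hK) T

section Measure

variable [Fintype ι] [MeasurableSpace X] {p : ι → ℝ≥0} {μ ν : Measure X}

/-- The measure of a neighbourhood `thickening δ T` is at most that of the smaller one with radius
`K' * δ`, for any `K < K' < 1`. Since the large ones exhaust the space, all of them have full
measure, and so has their intersection `T`. -/
theorem measure_compl_attractor [MetricSpace X] [BorelSpace X] (hK : K < 1)
    (hf : ∀ i, LipschitzWith K (f i)) (hp : ∑ i, p i = 1) [IsProbabilityMeasure μ]
    (hμ : ∀ E, MeasurableSet E → μ E = ∑ i, (p i : ℝ≥0∞) * μ (f i ⁻¹' E))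
    {T : Set X} (hTc : IsClosed T) (hTn : T.Nonempty) (hT : ⋃ i, f i '' T ⊆ T) :
    μ Tᶜ = 0 := by
  have hp' : ∑ i, (p i : ℝ≥0∞) = 1 := by exact_mod_cast hp
  have step (δ : ℝ) : μ (thickening δ T) ≤ μ (cthickening (K * δ) T) := by
    rw [hμ _ isClosed_cthickening.measurableSet]
    calc μ (thickening δ T) = ∑ i, (p i : ℝ≥0∞) * μ (thickening δ T) := by
          rw [← Finset.sum_mul, hp', one_mul]
      _ ≤ _ := by
          gcongr with i
          refine image_subset_iff.1 ((image_thickening_subset (hf i) δ T).trans ?_)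
          exact cthickening_subset_of_subset _ ((subset_iUnion _ i).trans hT)
  -- `K` may vanish, and a closed thickening fits into an open one only with a larger radius
  obtain ⟨K', hKK', hK'⟩ := exists_between hK
  have hK'0 : (0 : ℝ) < K' := by exact_mod_cast (zero_le (a := K)).trans_lt hKK'
  have step' (δ : ℝ) (hδ : 0 < δ) (n : ℕ) : μ (thickening δ T) ≤ μ (thickening (K' ^ n * δ) T) := by
    induction n with
    | zero => simp
    | succ n ih =>
      refine ih.trans ((step _).trans (measure_mono ?_))
      refine cthickening_subset_thickening' (by positivity) ?_ T
      rw [pow_succ', mul_assoc]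
      exact mul_lt_mul_of_pos_right (by exact_mod_cast hKK') (by positivity)
  have full (ε : ℝ) (hε : 0 < ε) : μ (thickening ε T) = 1 := by
    refine le_antisymm prob_le_one ?_
    have hmono : Monotone fun n : ℕ => thickening ((n : ℝ) + 1) T := fun m n hmn =>
      thickening_mono (by gcongr) T
    have hU : ⋃ n : ℕ, thickening ((n : ℝ) + 1) T = univ := by
      refine eq_univ_of_forall fun x => ?_
      obtain ⟨y, hy⟩ := hTn
      obtain ⟨n, hn⟩ := exists_nat_gt (dist x y)
      exact mem_iUnion.2 ⟨n, mem_thickening_iff.2 ⟨y, hy, by linarith⟩⟩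
    have hlim := tendsto_measure_iUnion_atTop (μ := μ) hmono
    rw [hU, measure_univ] at hlim
    refine le_of_tendsto' hlim fun m => ?_
    obtain ⟨n, hn⟩ := ((tendsto_pow_mul_zero hK' ((m : ℝ) + 1)).eventually_lt_const hε).exists
    exact (step' _ (by positivity) n).trans (measure_mono (thickening_mono hn.le T))
  have hlim := tendsto_measure_thickening_of_isClosed (μ := μ) (s := T)
    ⟨1, one_pos, measure_ne_top _ _⟩ hTc
  have h1 : Tendsto (fun r => μ (thickening r T)) (𝓝[>] 0) (𝓝 1) :=
    tendsto_const_nhds.congr' (by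
      filter_upwards [self_mem_nhdsWithin] with r hr using (full r hr).symm)
  rw [prob_compl_eq_zero_iff hTc.measurableSet]
  exact tendsto_nhds_unique hlim h1

/-- Each application of the two invariance equations improves a comparison of `μ` and `ν` up to
distance `δ` to one up to distance `K * δ`. -/
theorem measure_le_measure_thickening [MetricSpace X] [BorelSpace X]
    (hf : ∀ i, LipschitzWith K (f i))
    [IsProbabilityMeasure μ] [IsProbabilityMeasure ν]
    (hμ : ∀ E, MeasurableSet E → μ E = ∑ i, (p i : ℝ≥0∞) * μ (f i ⁻¹' E))
    (hν : ∀ E, MeasurableSet E → ν E = ∑ i, (p i : ℝ≥0∞) * ν (f i ⁻¹' E))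
    {T : Set X} {D : ℝ} (hTD : ∀ x ∈ T, ∀ y ∈ T, dist x y < D)
    (hμT : μ Tᶜ = 0) (hνT : ν Tᶜ = 0) (hK : 0 < K) (n : ℕ) :
    ∀ E, MeasurableSet E → μ E ≤ ν (thickening (K ^ n * D) E) := by
  induction n with
  | zero =>
    intro E hE
    simp only [pow_zero, one_mul]
    by_cases h : (E ∩ T).Nonempty
    · obtain ⟨x, hxE, hxT⟩ := h
      have hsub : T ⊆ thickening D E := fun y hy => mem_thickening_iff.2 ⟨x, hxE, hTD y hy x hxT⟩
      have : ν (thickening D E) = 1 :=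
        (prob_compl_eq_zero_iff isOpen_thickening.measurableSet).1
          (measure_mono_null (compl_subset_compl.2 hsub) hνT)
      rw [this]
      exact prob_le_one
    · have : E ⊆ Tᶜ := fun x hx hxT => h ⟨x, hx, hxT⟩
      rw [measure_mono_null this hμT]
      exact zero_le
  | succ n ih =>
    intro E hE
    rw [hμ E hE, hν _ isOpen_thickening.measurableSet]
    refine Finset.sum_le_sum fun i _ => mul_le_mul_right ?_ _
    refine (ih _ ((hf i).continuous.measurable hE)).trans (measure_mono ?_)
    intro x hx
    obtain ⟨y, hy, hxy⟩ := mem_thickening_iff.1 hx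
    refine mem_thickening_iff.2 ⟨f i y, hy, ?_⟩
    calc dist (f i x) (f i y) ≤ K * dist x y := (hf i).dist_le_mul _ _
      _ < K * (K ^ n * D) := mul_lt_mul_of_pos_left hxy (by exact_mod_cast hK)
      _ = K ^ (n + 1) * D := by ring

theorem invariantMeasure_unique [MetricSpace X] [CompleteSpace X] [BorelSpace X] [Nonempty ι]
    (hK : K < 1) (hf : ∀ i, LipschitzWith K (f i)) (hp : ∑ i, p i = 1)
    [IsProbabilityMeasure μ] [IsProbabilityMeasure ν]
    (hμ : ∀ E, MeasurableSet E → μ E = ∑ i, (p i : ℝ≥0∞) * μ (f i ⁻¹' E))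
    (hν : ∀ E, MeasurableSet E → ν E = ∑ i, (p i : ℝ≥0∞) * ν (f i ⁻¹' E)) : μ = ν := by
  have : Nonempty X := nonempty_of_isProbabilityMeasure μ
  obtain ⟨T, ⟨hTn, hTc, hT⟩, -⟩ := existsUnique_attractor hK hf
  obtain ⟨D, hD⟩ := isBounded_iff.1 hTc.isBounded
  obtain ⟨K', hKK', hK'⟩ := exists_between hK
  have hK'0 : 0 < K' := (zero_le (a := K)).trans_lt hKK'
  have hf' : ∀ i, LipschitzWith K' (f i) := fun i => (hf i).weaken hKK'.le
  have hD' : ∀ x ∈ T, ∀ y ∈ T, dist x y < D + 1 := fun x hx y hy =>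
    (hD hx hy).trans_lt (lt_add_one D)
  have key : ∀ (μ ν : Measure X) [IsProbabilityMeasure μ] [IsProbabilityMeasure ν],
      (∀ E, MeasurableSet E → μ E = ∑ i, (p i : ℝ≥0∞) * μ (f i ⁻¹' E)) →
      (∀ E, MeasurableSet E → ν E = ∑ i, (p i : ℝ≥0∞) * ν (f i ⁻¹' E)) →
      ∀ F, IsClosed F → μ F ≤ ν F := by
    intro μ ν _ _ hμ hν F hF
    have hμT := measure_compl_attractor hK hf hp hμ hTc.isClosed hTn hT.ge
    have hνT := measure_compl_attractor hK hf hp hν hTc.isClosed hTn hT.ge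
    have hlim := tendsto_measure_thickening_of_isClosed (μ := ν) (s := F)
      ⟨1, one_pos, measure_ne_top _ _⟩ hF
    have h0 : Tendsto (fun n : ℕ => (K' : ℝ) ^ n * (D + 1)) atTop (𝓝[>] 0) := by
      refine tendsto_nhdsWithin_iff.2 ⟨tendsto_pow_mul_zero hK' _, .of_forall fun n => ?_⟩
      have : (0 : ℝ) < D + 1 := by
        obtain ⟨x, hx⟩ := hTn
        exact dist_nonneg.trans_lt (hD' x hx x hx)
      exact mul_pos (pow_pos (by exact_mod_cast hK'0) n) this
    exact ge_of_tendsto' (hlim.comp h0) fun n =>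
      measure_le_measure_thickening hf' hμ hν hD' hμT hνT hK'0 n F hF.measurableSet
  refine ext_of_generate_finite _ (BorelSpace.measurable_eq.trans
    borel_eq_generateFrom_isClosed) isPiSystem_isClosed (fun F hF => ?_) (by simp)
  exact le_antisymm (key μ ν hμ hν F hF) (key ν μ hν hμ F hF)

/-- Putting an independent `ρ`-distributed term in front of a sequence of independent
`ρ`-distributed terms gives a sequence with the same law. -/
theorem map_seqCons_prod_infinitePi {α : Type*} [MeasurableSpace α] (ρ : Measure α)
    [IsProbabilityMeasure ρ] :
    (ρ.prod (Measure.infinitePi fun _ : ℕ => ρ)).map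
      (fun q => seqCons q.1 q.2 : α × (ℕ → α) → ℕ → α) =
      Measure.infinitePi fun _ : ℕ => ρ := by
  refine Measure.eq_infinitePi _ fun s t ht => ?_
  classical
  obtain ⟨N, hN⟩ := s.exists_nat_subset_range
  -- extending the box by `univ` makes its index set an initial segment, which the shift respects
  set t' : ℕ → Set α := fun n => if n ∈ s then t n else univ with ht'_def
  have ht' : ∀ n, MeasurableSet (t' n) := fun n => by
    by_cases h : n ∈ s <;> simp [t', h, ht n]
  have hpre : (fun q => seqCons q.1 q.2 : α × (ℕ → α) → ℕ → α) ⁻¹' (s : Set ℕ).pi t =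
      t' 0 ×ˢ ((Finset.range N : Set ℕ).pi fun n => t' (n + 1)) := by
    ext ⟨a, ω⟩
    simp only [mem_preimage, Set.mem_pi, Finset.mem_coe, mem_prod, Finset.mem_range, t']
    constructor
    · intro h
      refine ⟨?_, fun n _ => ?_⟩
      · by_cases h0 : 0 ∈ s
        · simpa [h0, seqCons] using h 0 h0
        · simp [h0]
      · by_cases h0 : n + 1 ∈ s
        · simpa [h0, seqCons] using h (n + 1) h0
        · simp [h0]
    · rintro ⟨h0, h1⟩ n hn
      cases n with
      | zero => simpa [hn, seqCons] using h0
      | succ n =>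
        have := h1 n (by have := Finset.mem_range.1 (hN hn); omega)
        simpa [hn, seqCons] using this
  rw [Measure.map_apply measurable_seqCons (MeasurableSet.pi s.countable_toSet fun n _ => ht n),
    hpre,
    Measure.prod_prod, Measure.infinitePi_pi _ fun n _ => ht' (n + 1), mul_comm,
    ← Finset.prod_range_succ' (fun n => ρ (t' n))]
  symm
  calc ∏ n ∈ s, ρ (t n) = ∏ n ∈ s, ρ (t' n) :=
        Finset.prod_congr rfl fun n hn => by simp [t', hn]
    _ = _ := Finset.prod_subset (hN.trans (Finset.range_mono N.le_succ)) fun n _ hn => by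
        simp [t', hn]

/-- The invariant measure is the law of `π ω` for a sequence `ω` of independent indices with
distribution `p`, where `π` is the coding map. -/
theorem exists_invariantMeasure [MetricSpace X] [CompleteSpace X] [BorelSpace X] [Nonempty X]
    (hK : K < 1) (hf : ∀ i, LipschitzWith K (f i)) (hp : ∑ i, p i = 1) :
    ∃ μ : Measure X, IsProbabilityMeasure μ ∧
      ∀ E, MeasurableSet E → μ E = ∑ i, (p i : ℝ≥0∞) * μ (f i ⁻¹' E) := by
  let _ : TopologicalSpace ι := ⊥
  have : DiscreteTopology ι := ⟨rfl⟩
  let _ : MeasurableSpace ι := ⊤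
  have : BorelSpace ι := ⟨borel_eq_top_of_discrete.symm⟩
  obtain ⟨π, hπc, hπf⟩ := exists_codingMap hK hf
  let ρ : Measure ι := ∑ i, (p i : ℝ≥0∞) • Measure.dirac i
  have hρ : IsProbabilityMeasure ρ := ⟨by
    simp only [ρ, Measure.finsetSum_apply, Measure.smul_apply, measure_univ, smul_eq_mul, mul_one]
    exact_mod_cast hp⟩
  let P : Measure (ℕ → ι) := Measure.infinitePi fun _ => ρ
  have hπm : Measurable π := hπc.measurable
  refine ⟨P.map π, Measure.isProbabilityMeasure_map hπm.aemeasurable, fun E hE => ?_⟩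
  have hslice : ∀ i, (Prod.mk i ⁻¹' ((fun q => seqCons q.1 q.2 : ι × (ℕ → ι) → ℕ → ι) ⁻¹'
      (π ⁻¹' E))) = π ⁻¹' (f i ⁻¹' E) := fun i => by
    ext ω
    simp only [mem_preimage]
    rw [hπf]
    rfl
  rw [Measure.map_apply hπm hE]
  conv_lhs => rw [show P = _ from (map_seqCons_prod_infinitePi ρ).symm]
  rw [Measure.map_apply measurable_seqCons (hπm hE),
    Measure.prod_apply (measurable_seqCons (hπm hE))]
  simp only [hslice]
  simp only [ρ, lintegral_finsetSum_measure, lintegral_smul_measure, lintegral_dirac, smul_eq_mul]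
  refine Finset.sum_congr rfl fun i _ => ?_
  rw [Measure.map_apply hπm ((hf i).continuous.measurable hE)]

end Measure

end Contractive

/-! ### A metric contracted by the inverse of an expansive matrix -/

section Expansive

variable {d : ℕ} {R : Matrix (Fin d) (Fin d) ℤ}

theorem Expansive.det_ne_zero (hR : Expansive R) : R.det ≠ 0 := by
  intro h
  have hC : (R.map (Int.cast : ℤ → ℂ)).det = 0 := by
    have := (Int.castRingHom ℂ).map_det R
    rw [h] at this
    simpa using this.symm
  obtain ⟨v, hv, hRv⟩ := Matrix.exists_mulVec_eq_zero_iff.2 hC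
  have h0 := hR 0 (Module.End.hasEigenvalue_of_hasEigenvector
    (Module.End.hasEigenvector_iff.2 ⟨Module.End.mem_eigenspace_iff.2 (by simpa using hRv), hv⟩))
  simp at h0
  linarith

theorem Expansive.isUnit_det_map (hR : Expansive R) (k : Type*) [Field k] [CharZero k] :
    IsUnit (R.map (Int.cast : ℤ → k)).det := by
  have h : (R.map (Int.cast : ℤ → k)).det = (R.det : k) := ((Int.castRingHom k).map_det R).symm
  rw [h, isUnit_iff_ne_zero]
  exact_mod_cast hR.det_ne_zero

attribute [local instance] Matrix.linftyOpNormedRing Matrix.linftyOpNormedAlgebra in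
/-- Gelfand's formula for `R⁻¹`, whose eigenvalues are the inverses of those of `R`. The spectral
radius is `0` when `d = 0`. -/
theorem Expansive.exists_norm_inv_pow_le (hR : Expansive R) :
    ∃ K : ℝ≥0, 0 < K ∧ K < 1 ∧ ∃ N : ℕ, 0 < N ∧
      ∀ x : Fin d → ℂ, ‖((R.map (Int.cast : ℤ → ℂ))⁻¹ ^ N) *ᵥ x‖ ≤ K ^ N * ‖x‖ := by
  set M := R.map (Int.cast : ℤ → ℂ) with hM
  have hu : IsUnit M := (Matrix.isUnit_iff_isUnit_det _).2 (hR.isUnit_det_map ℂ)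
  have hspec : ∀ z ∈ spectrum ℂ M⁻¹, ‖z‖₊ < 1 := by
    intro z hz
    obtain ⟨U, hU⟩ := hu
    rw [← hU, ← Matrix.coe_units_inv, ← spectrum.map_inv, Set.mem_inv, hU,
      ← Matrix.spectrum_toLin', ← Module.End.hasEigenvalue_iff_mem_spectrum] at hz
    have h1 := hR _ hz
    rw [norm_inv] at h1
    by_contra! h
    have : (1 : ℝ) ≤ ‖z‖ := by exact_mod_cast h
    exact absurd (inv_le_one_of_one_le₀ this) (not_le.2 h1)
  have hrad : spectralRadius ℂ M⁻¹ < 1 := by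
    rcases (spectrum ℂ M⁻¹).eq_empty_or_nonempty with h | h
    · simp [spectralRadius, h]
    · exact_mod_cast spectrum.spectralRadius_lt_of_forall_lt_of_nonempty h hspec
  obtain ⟨K, hK, hK1⟩ := ENNReal.lt_iff_exists_nnreal_btwn.1 hrad
  have hK0 : 0 < K := by exact_mod_cast (zero_le (a := spectralRadius ℂ M⁻¹)).trans_lt hK
  have hev := (spectrum.pow_nnnorm_pow_one_div_tendsto_nhds_spectralRadius M⁻¹).eventually_lt_const
    hK
  obtain ⟨N, hN, hN0⟩ := (hev.and (Filter.eventually_gt_atTop 0)).exists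
  refine ⟨K, hK0, by exact_mod_cast hK1, N, hN0, fun x => ?_⟩
  refine (Matrix.linfty_opNorm_mulVec _ _).trans ?_
  gcongr
  have hN' : ((N : ℝ)) ≠ 0 := by positivity
  have h2 : (‖M⁻¹ ^ N‖₊ : ℝ≥0∞) ≤ (K : ℝ≥0∞) ^ N := by
    have := ENNReal.rpow_le_rpow hN.le (Nat.cast_nonneg N : (0 : ℝ) ≤ N)
    rwa [← ENNReal.rpow_mul, one_div_mul_cancel hN', ENNReal.rpow_one, ENNReal.rpow_natCast] at this
  exact_mod_cast h2

theorem norm_ofReal_comp (x : Fin d → ℝ) : ‖fun i => (x i : ℂ)‖ = ‖x‖ := by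
  simp [Pi.norm_def]

theorem map_inv_mulVec_ofReal (hR : Expansive R) (x : Fin d → ℝ) :
    (fun i => (((R.map (Int.cast : ℤ → ℝ))⁻¹ *ᵥ x) i : ℂ)) =
      (R.map (Int.cast : ℤ → ℂ))⁻¹ *ᵥ fun i => (x i : ℂ) := by
  have h : R.map (Int.cast : ℤ → ℂ) = (R.map (Int.cast : ℤ → ℝ)).map Complex.ofRealHom := by
    ext i j; simp
  have hx : (fun i => (x i : ℂ)) = R.map (Int.cast : ℤ → ℂ) *ᵥ
      fun i => (((R.map (Int.cast : ℤ → ℝ))⁻¹ *ᵥ x) i : ℂ) := by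
    have h1 : x = R.map (Int.cast : ℤ → ℝ) *ᵥ ((R.map (Int.cast : ℤ → ℝ))⁻¹ *ᵥ x) := by
      rw [Matrix.mulVec_mulVec, Matrix.mul_nonsing_inv _ (hR.isUnit_det_map ℝ), Matrix.one_mulVec]
    rw [h]
    ext i
    conv_lhs => rw [h1]
    exact RingHom.map_mulVec Complex.ofRealHom _ _ i
  rw [hx, Matrix.mulVec_mulVec, Matrix.nonsing_inv_mul _ (hR.isUnit_det_map ℂ), Matrix.one_mulVec]

theorem Expansive.exists_norm_inv_pow_le_real (hR : Expansive R) :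
    ∃ K : ℝ≥0, 0 < K ∧ K < 1 ∧ ∃ N : ℕ, 0 < N ∧
      ∀ x : Fin d → ℝ, ‖((R.map (Int.cast : ℤ → ℝ))⁻¹ ^ N) *ᵥ x‖ ≤ K ^ N * ‖x‖ := by
  obtain ⟨K, hK0, hK1, N, hN, h⟩ := hR.exists_norm_inv_pow_le
  refine ⟨K, hK0, hK1, N, hN, fun x => ?_⟩
  have hpow : ∀ n, (fun i => ((((R.map (Int.cast : ℤ → ℝ))⁻¹ ^ n) *ᵥ x) i : ℂ)) =
      ((R.map (Int.cast : ℤ → ℂ))⁻¹ ^ n) *ᵥ fun i => (x i : ℂ) := by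
    intro n
    induction n with
    | zero => simp
    | succ n ih =>
      rw [pow_succ', pow_succ', ← Matrix.mulVec_mulVec, ← Matrix.mulVec_mulVec,
        map_inv_mulVec_ofReal hR, ih]
  rw [← norm_ofReal_comp, hpow, ← norm_ofReal_comp x]
  exact h _

/-- The linear embedding `x ↦ (K⁻ᵏ Aᵏ x)_{k < N}`. The sup norm of the image is a norm of `x` which
`A` multiplies by at most `K` as soon as `‖A ^ N x‖ ≤ K ^ N ‖x‖` for all `x`. -/
noncomputable def orbitEmbedding (A : Matrix (Fin d) (Fin d) ℝ) (K : ℝ≥0) (N : ℕ) :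
    (Fin d → ℝ) →ₗ[ℝ] Fin N → Fin d → ℝ :=
  LinearMap.pi fun k => ((K : ℝ) ^ (k : ℕ))⁻¹ • (A ^ (k : ℕ)).mulVecLin

theorem orbitEmbedding_apply (A : Matrix (Fin d) (Fin d) ℝ) (K : ℝ≥0) (N : ℕ) (x : Fin d → ℝ)
    (k : Fin N) : orbitEmbedding A K N x k = ((K : ℝ) ^ (k : ℕ))⁻¹ • ((A ^ (k : ℕ)) *ᵥ x) := rfl

theorem norm_le_norm_orbitEmbedding (A : Matrix (Fin d) (Fin d) ℝ) (K : ℝ≥0) {N : ℕ} (hN : 0 < N)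
    (x : Fin d → ℝ) : ‖x‖ ≤ ‖orbitEmbedding A K N x‖ := by
  have := norm_le_pi_norm (orbitEmbedding A K N x) ⟨0, hN⟩
  simpa [orbitEmbedding_apply] using this

theorem norm_orbitEmbedding_mulVec_le {A : Matrix (Fin d) (Fin d) ℝ} {K : ℝ≥0} (hK : 0 < K) {N : ℕ}
    (hA : ∀ x : Fin d → ℝ, ‖(A ^ N) *ᵥ x‖ ≤ K ^ N * ‖x‖) (x : Fin d → ℝ) :
    ‖orbitEmbedding A K N (A *ᵥ x)‖ ≤ K * ‖orbitEmbedding A K N x‖ := by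
  have hK' : (0 : ℝ) < K := by exact_mod_cast hK
  refine (pi_norm_le_iff_of_nonneg (by positivity)).2 fun k => ?_
  have hN : 0 < N := k.pos
  rw [orbitEmbedding_apply, Matrix.mulVec_mulVec, ← pow_succ, norm_smul, norm_inv, norm_pow,
    Real.norm_of_nonneg hK'.le, inv_mul_le_iff₀ (by positivity), ← mul_assoc, ← pow_succ]
  rcases Nat.lt_or_ge (k + 1) N with h | h
  · have := norm_le_pi_norm (orbitEmbedding A K N x) ⟨k + 1, h⟩
    rwa [orbitEmbedding_apply, norm_smul, norm_inv, norm_pow,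
      Real.norm_of_nonneg hK'.le, inv_mul_le_iff₀ (by positivity)] at this
  -- at the last coordinate the bound on `A ^ N` closes the cycle
  · have hk : (k : ℕ) + 1 = N := le_antisymm k.2 h
    rw [hk]
    exact (hA x).trans (by gcongr; exact norm_le_norm_orbitEmbedding A K hN x)

theorem isUniformEmbedding_orbitEmbedding (A : Matrix (Fin d) (Fin d) ℝ) (K : ℝ≥0) {N : ℕ}
    (hN : 0 < N) : IsUniformEmbedding (orbitEmbedding A K N) :=
  (AddMonoidHomClass.antilipschitz_of_bound (K := 1) (orbitEmbedding A K N) fun x => by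
    simpa using norm_le_norm_orbitEmbedding A K hN x).isUniformEmbedding
    (LinearMap.toContinuousLinearMap (orbitEmbedding A K N)).uniformContinuous

/-- The metric `dist' x y = sup_{k < N} K⁻ᵏ ‖Aᵏ (x - y)‖` on `ℝ^d`. Its uniform structure is
definitionally the usual one, so that continuity, compactness, completeness and the Borel sets
keep their usual meaning. -/
noncomputable abbrev orbitMetricSpace (A : Matrix (Fin d) (Fin d) ℝ) (K : ℝ≥0) {N : ℕ}
    (hN : 0 < N) : MetricSpace (Fin d → ℝ) :=
  (isUniformEmbedding_orbitEmbedding A K hN).comapMetricSpace _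

theorem dist_le_orbitMetricSpace_dist (A : Matrix (Fin d) (Fin d) ℝ) (K : ℝ≥0) {N : ℕ}
    (hN : 0 < N) (x y : Fin d → ℝ) : dist x y ≤ (orbitMetricSpace A K hN).dist x y := by
  change _ ≤ dist (orbitEmbedding A K N x) (orbitEmbedding A K N y)
  rw [dist_eq_norm, dist_eq_norm, ← map_sub]
  exact norm_le_norm_orbitEmbedding A K hN _

theorem Expansive.exists_lipschitzWith_tau (hR : Expansive R) :
    ∃ K : ℝ≥0, K < 1 ∧ ∃ (N : ℕ) (hN : 0 < N), ∀ b,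
      letI m := (orbitMetricSpace (R.map (Int.cast : ℤ → ℝ))⁻¹ K hN).toPseudoMetricSpace
      @LipschitzWith _ _ m.toPseudoEMetricSpace m.toPseudoEMetricSpace K (tau R b) := by
  obtain ⟨K, hK0, hK1, N, hN, h⟩ := hR.exists_norm_inv_pow_le_real
  refine ⟨K, hK1, N, hN, fun b => ?_⟩
  set A := (R.map (Int.cast : ℤ → ℝ))⁻¹ with hA
  refine @LipschitzWith.of_dist_le_mul _ _ (orbitMetricSpace A K hN).toPseudoMetricSpace
    (orbitMetricSpace A K hN).toPseudoMetricSpace _ _ fun x y => ?_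
  change dist (orbitEmbedding A K N (tau R b x)) (orbitEmbedding A K N (tau R b y)) ≤
    K * dist (orbitEmbedding A K N x) (orbitEmbedding A K N y)
  rw [dist_eq_norm, dist_eq_norm, ← map_sub, ← map_sub, tau, tau, ← Matrix.mulVec_sub,
    add_sub_add_right_eq_sub]
  exact norm_orbitEmbedding_mulVec_le hK0 h _

end Expansive

/-! ### Words, digit sums and separation -/

section Words

open Set

variable {d : ℕ} {R : Matrix (Fin d) (Fin d) ℤ} {B : Finset (Fin d → ℤ)} {T V : Set (Fin d → ℝ)}

/-- The composition `τ_{b₁} ∘ ⋯ ∘ τ_{bₙ}` along the word `b₁ ⋯ bₙ`. -/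
noncomputable def tauWord (R : Matrix (Fin d) (Fin d) ℤ) :
    List (Fin d → ℤ) → (Fin d → ℝ) → (Fin d → ℝ)
  | [] => id
  | b :: w => tau R b ∘ tauWord R w

/-- The integer vector `R ^ (n - 1) b₁ + ⋯ + R bₙ₋₁ + bₙ` with digits `b₁, …, bₙ`. The map
`tauWord R w` is `x ↦ R ^ (-n) (x + digitSum R w)`. -/
def digitSum (R : Matrix (Fin d) (Fin d) ℤ) : List (Fin d → ℤ) → (Fin d → ℤ)
  | [] => 0
  | b :: w => digitSum R w + (R ^ w.length) *ᵥ b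

theorem tauWord_append (v w : List (Fin d → ℤ)) :
    tauWord R (v ++ w) = tauWord R v ∘ tauWord R w := by
  induction v with
  | nil => rfl
  | cons b v ih => rw [List.cons_append, tauWord, ih, tauWord, Function.comp_assoc]

theorem digitSum_append (v w : List (Fin d → ℤ)) :
    digitSum R (v ++ w) = digitSum R w + (R ^ w.length) *ᵥ digitSum R v := by
  induction v with
  | nil => simp [digitSum]
  | cons b v ih =>
    rw [List.cons_append, digitSum, ih, digitSum, Matrix.mulVec_add, List.length_append,
      Matrix.mulVec_mulVec, ← pow_add, add_assoc, add_comm v.length]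

theorem mulVec_tau (hR : Expansive R) (b : Fin d → ℤ) (x : Fin d → ℝ) :
    R.map (Int.cast : ℤ → ℝ) *ᵥ tau R b x = x + fun i => (b i : ℝ) := by
  rw [tau, Matrix.mulVec_mulVec, Matrix.mul_nonsing_inv _ (hR.isUnit_det_map ℝ),
    Matrix.one_mulVec]

theorem pow_mulVec_tauWord (hR : Expansive R) (w : List (Fin d → ℤ)) (x : Fin d → ℝ) :
    (R.map (Int.cast : ℤ → ℝ) ^ w.length) *ᵥ tauWord R w x =
      x + fun i => (digitSum R w i : ℝ) := by
  induction w with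
  | nil => ext i; simp [tauWord, digitSum]
  | cons b w ih =>
    have hb : (fun i => (((R ^ w.length) *ᵥ b) i : ℝ)) =
        (R.map (Int.cast : ℤ → ℝ) ^ w.length) *ᵥ fun i => (b i : ℝ) := by
      have : R.map (Int.cast : ℤ → ℝ) ^ w.length = (R ^ w.length).map (Int.castRingHom ℝ) :=
        (map_pow (Int.castRingHom ℝ).mapMatrix R w.length).symm
      rw [this]
      ext i
      exact RingHom.map_mulVec (Int.castRingHom ℝ) _ _ i
    rw [List.length_cons, pow_succ, ← Matrix.mulVec_mulVec, tauWord, Function.comp_apply,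
      mulVec_tau hR, Matrix.mulVec_add, ih, ← hb, add_assoc]
    congr 1
    ext i
    simp [digitSum]

/-- Equal digit sums have equal least significant digits, as these are congruent modulo `R ℤ^d`;
subtracting the last digit and dividing by `R` shortens the words. -/
theorem SimpleDigitSet.eq_of_digitSum_eq (hR : Expansive R) (hB : SimpleDigitSet R B) (n : ℕ) :
    ∀ v w : List (Fin d → ℤ), (∀ c ∈ v, c ∈ B) → (∀ c ∈ w, c ∈ B) → v.length = n → w.length = n →
      digitSum R v = digitSum R w → v = w := by
  induction n with
  | zero =>
    intro v w _ _ hv hw _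
    rw [List.length_eq_zero_iff.1 hv, List.length_eq_zero_iff.1 hw]
  | succ n ih =>
    intro v w hvB hwB hv hw h
    rcases List.eq_nil_or_concat v with rfl | ⟨v, a, rfl⟩
    · simp at hv
    rcases List.eq_nil_or_concat w with rfl | ⟨w, c, rfl⟩
    · simp at hw
    simp only [List.concat_eq_append, digitSum_append, digitSum, List.length_singleton,
      List.length_append, List.length_nil, pow_zero, pow_one, zero_add,
      Matrix.one_mulVec, List.mem_append, List.mem_singleton, Nat.add_right_cancel_iff]
      at hvB hwB hv hw h ⊢
    have hac : a = c := by
      by_contra hac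
      refine hB.2 a (hvB a (.inr rfl)) c (hwB c (.inr rfl)) hac
        ⟨digitSum R w - digitSum R v, ?_⟩
      rw [Matrix.mulVec_sub, sub_eq_sub_iff_add_eq_add, h, add_comm]
    subst hac
    have hvw : R *ᵥ (digitSum R v - digitSum R w) = 0 := by
      rw [Matrix.mulVec_sub, sub_eq_zero, add_left_cancel h]
    have h0 := Matrix.eq_zero_of_mulVec_eq_zero hR.det_ne_zero hvw
    rw [ih v w (fun x hx => hvB x (.inl hx)) (fun x hx => hwB x (.inl hx)) hv hw
      (sub_eq_zero.1 h0)]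

theorem mapsTo_tauWord (hV : ∀ b ∈ B, tau R b '' V ⊆ V) {w : List (Fin d → ℤ)}
    (hw : ∀ c ∈ w, c ∈ B) : MapsTo (tauWord R w) V V := by
  induction w with
  | nil => exact mapsTo_id V
  | cons b w ih =>
    exact (mapsTo_iff_image_subset.2 (hV b (hw b (by simp)))).comp
      (ih fun c hc => hw c (List.mem_cons_of_mem _ hc))

theorem exists_eq_tauWord (hT : T ⊆ ⋃ b ∈ B, tau R b '' T) (n : ℕ) :
    ∀ t ∈ T, ∃ w : List (Fin d → ℤ), w.length = n ∧ (∀ c ∈ w, c ∈ B) ∧ ∃ t' ∈ T,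
      tauWord R w t' = t := by
  induction n with
  | zero => exact fun t ht => ⟨[], rfl, by simp, t, ht, rfl⟩
  | succ n ih =>
    intro t ht
    obtain ⟨b, hb, t₁, ht₁, rfl⟩ := mem_iUnion₂.1 (hT ht)
    obtain ⟨w, hw, hwB, t', ht', rfl⟩ := ih t₁ ht₁
    exact ⟨b :: w, by simp [hw], by simpa [hb] using hwB, t', ht', rfl⟩

theorem continuous_tau (b : Fin d → ℤ) : Continuous (tau R b) := by
  unfold tau
  exact (Continuous.matrix_mulVec continuous_const (continuous_id.add continuous_const))

theorem isOpenMap_tau (hR : Expansive R) (b : Fin d → ℤ) : IsOpenMap (tau R b) := by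
  refine IsOpenMap.of_inverse
    (f' := fun y => R.map (Int.cast : ℤ → ℝ) *ᵥ y - fun i => (b i : ℝ)) ?_ ?_ ?_
  · exact (Continuous.matrix_mulVec continuous_const continuous_id).sub continuous_const
  · intro y
    simp [tau, Matrix.mulVec_mulVec, Matrix.nonsing_inv_mul _ (hR.isUnit_det_map ℝ)]
  · intro x
    simp [mulVec_tau hR]

theorem isOpenMap_tauWord (hR : Expansive R) (w : List (Fin d → ℤ)) :
    IsOpenMap (tauWord R w) := by
  induction w with
  | nil => exact IsOpenMap.id
  | cons b w ih => exact (isOpenMap_tau hR b).comp ih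

theorem continuous_tauWord (w : List (Fin d → ℤ)) : Continuous (tauWord R w) := by
  induction w with
  | nil => exact continuous_id
  | cons b w ih => exact (continuous_tau b).comp ih

theorem finite_setOf_exists_add_mem (hV : Bornology.IsBounded V) :
    {z : Fin d → ℤ | ∃ x ∈ V, (x + fun i => (z i : ℝ)) ∈ V}.Finite := by
  obtain ⟨r, hr⟩ := hV.subset_closedBall 0
  refine (isCompact_closedBall (0 : Fin d → ℤ) (2 * r)).finite_of_discrete.subset ?_
  rintro z ⟨x, hx, hxz⟩
  have h1 := mem_closedBall_zero_iff.1 (hr hx)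
  have h2 := mem_closedBall_zero_iff.1 (hr hxz)
  have h3 : ‖fun i => (z i : ℝ)‖ ≤ 2 * r := by
    have := norm_sub_le (x + fun i => (z i : ℝ)) x
    rw [add_sub_cancel_left] at this
    linarith
  rw [mem_closedBall_zero_iff]
  refine (pi_norm_le_iff_of_nonneg ((norm_nonneg _).trans h3)).2 fun i => ?_
  rw [← Int.norm_cast_real]
  exact (norm_le_pi_norm (fun i => (z i : ℝ)) i).trans h3

/-- A word `I` with a maximal set of neighbours separates the first level pieces: no piece
`τ_b (τ_{K I} V)` meets a piece of the same level starting with a digit other than `b`. A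
*neighbour* of `w` is a vector `z = digitSum J - digitSum w`, with `J` as long as `w`, such that
`V + z` meets `V`. Every neighbour of `I` is one of `K I`, through the word `K J`; by maximality
and uniqueness of digit expansions there are no other words close to `K I`. -/
theorem exists_separating_word (hR : Expansive R) (hB : SimpleDigitSet R B)
    (hVb : Bornology.IsBounded V) :
    ∃ I : List (Fin d → ℤ), (∀ c ∈ I, c ∈ B) ∧ ∀ b ∈ B, ∀ b' ∈ B, b ≠ b' →
      ∀ K L : List (Fin d → ℤ), (∀ c ∈ K, c ∈ B) → (∀ c ∈ L, c ∈ B) →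
      L.length = K.length + I.length → ∀ x ∈ V, ∀ y ∈ V,
      tau R b (tauWord R (K ++ I) x) ≠ tau R b' (tauWord R L y) := by
  set F := {z : Fin d → ℤ | ∃ x ∈ V, (x + fun i => (z i : ℝ)) ∈ V} with hF
  let N : List (Fin d → ℤ) → Set (Fin d → ℤ) := fun w =>
    {z ∈ F | ∃ J : List (Fin d → ℤ), (∀ c ∈ J, c ∈ B) ∧ J.length = w.length ∧
      digitSum R J - digitSum R w = z}
  have hNfin : (N '' {w | ∀ c ∈ w, c ∈ B}).Finite := by
    refine (finite_setOf_exists_add_mem hVb).finite_subsets.subset ?_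
    rintro _ ⟨w, -, rfl⟩
    exact fun z hz => hz.1
  obtain ⟨_, ⟨I, hI, rfl⟩, hmax⟩ := hNfin.exists_maximal ⟨_, [], by simp, rfl⟩
  have happ : ∀ K J : List (Fin d → ℤ), J.length = I.length →
      digitSum R (K ++ J) - digitSum R (K ++ I) = digitSum R J - digitSum R I := by
    intro K J hJ
    rw [digitSum_append, digitSum_append, hJ, add_sub_add_right_eq_sub]
  refine ⟨I, hI, fun b hb b' hb' hbb K L hK hL hlen x hx y hy heq => hbb ?_⟩
  have hbK : ∀ c ∈ b :: K, c ∈ B := by simpa [hb] using hK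
  have hbL : ∀ c ∈ b' :: L, c ∈ B := by simpa [hb'] using hL
  have hlen' : (b' :: L).length = ((b :: K) ++ I).length := by simp [hlen]
  have hsub : N I ⊆ N ((b :: K) ++ I) := by
    rintro z ⟨hz, J, hJ, hJl, rfl⟩
    refine ⟨hz, (b :: K) ++ J, ?_, by simp [hJl], happ _ J hJl⟩
    intro c hc
    rcases List.mem_append.1 hc with h | h
    exacts [hbK c h, hJ c h]
  have hmem : (∀ c ∈ (b :: K) ++ I, c ∈ B) := by
    intro c hc
    rcases List.mem_append.1 hc with h | h
    exacts [hbK c h, hI c h]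
  have hzF : digitSum R (b' :: L) - digitSum R ((b :: K) ++ I) ∈ F := by
    refine ⟨y, hy, ?_⟩
    have h1 := pow_mulVec_tauWord hR ((b :: K) ++ I) x
    have h2 := pow_mulVec_tauWord hR (b' :: L) y
    have heq' : tauWord R ((b :: K) ++ I) x = tauWord R (b' :: L) y := heq
    rw [hlen', ← heq', h1] at h2
    convert hx using 1
    ext i
    have := congrFun h2 i
    simp only [Pi.add_apply, Pi.sub_apply, Int.cast_sub] at this ⊢
    linarith
  obtain ⟨-, J, hJ, hJl, hJz⟩ : digitSum R (b' :: L) - digitSum R ((b :: K) ++ I) ∈ N I :=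
    hmax ⟨_, hmem, rfl⟩ hsub ⟨hzF, b' :: L, hbL, hlen', rfl⟩
  rw [← happ (b :: K) J hJl] at hJz
  have hfin := hB.eq_of_digitSum_eq hR _ ((b :: K) ++ J) (b' :: L) (by
    intro c hc
    rcases List.mem_append.1 hc with h | h
    exacts [hbK c h, hJ c h]) hbL rfl (by rw [hlen']; simp [hJl]) (sub_left_injective hJz)
  exact (List.cons_eq_cons.1 hfin).1

/-- The union `U` of the sets `τ_{K I} V`, with `I` a separating word and `K` any word. -/
theorem exists_isOpen_separated (hR : Expansive R) (hB : SimpleDigitSet R B)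
    (hVo : IsOpen V) (hVb : Bornology.IsBounded V) (hV : ∀ b ∈ B, tau R b '' V ⊆ V)
    (hTV : T ⊆ V) (hT : T ⊆ ⋃ b ∈ B, tau R b '' T) :
    ∃ U : Set (Fin d → ℝ), IsOpen U ∧ (∀ b ∈ B, tau R b '' U ⊆ U) ∧
      (∀ b ∈ B, ∀ b' ∈ B, b ≠ b' → tau R b '' U ∩ tau R b' '' U = ∅) ∧
      (∀ b ∈ B, ∀ b' ∈ B, b ≠ b' → tau R b '' U ∩ tau R b' '' T = ∅) ∧
      ∃ I : List (Fin d → ℤ), (∀ c ∈ I, c ∈ B) ∧ tauWord R I '' V ⊆ U := by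
  obtain ⟨I, hI, hsep⟩ := exists_separating_word hR hB hVb
  have hdisj : ∀ b ∈ B, ∀ b' ∈ B, b ≠ b' → ∀ K K' : List (Fin d → ℤ), (∀ c ∈ K, c ∈ B) →
      (∀ c ∈ K', c ∈ B) → K.length ≤ K'.length → ∀ x ∈ V, ∀ y ∈ V,
      tau R b (tauWord R (K ++ I) x) ≠ tau R b' (tauWord R (K' ++ I) y) := by
    intro b hb b' hb' hbb K K' hK hK' hle x hx y hy
    have hK'I : ∀ c ∈ K' ++ I, c ∈ B := by
      intro c hc
      rcases List.mem_append.1 hc with h | h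
      exacts [hK' c h, hI c h]
    -- the longer word is cut down to the length of the shorter one
    have hcut : tauWord R (K' ++ I) y = tauWord R ((K' ++ I).take (K.length + I.length))
        (tauWord R ((K' ++ I).drop (K.length + I.length)) y) := by
      rw [← Function.comp_apply (f := tauWord R _), ← tauWord_append, List.take_append_drop]
    rw [hcut]
    refine hsep b hb b' hb' hbb K _ hK (fun c hc => hK'I c (List.mem_of_mem_take hc)) ?_ x hx _
      (mapsTo_tauWord hV (fun c hc => hK'I c (List.mem_of_mem_drop hc)) hy)
    simp
    omega
  refine ⟨⋃ K ∈ {K : List (Fin d → ℤ) | ∀ c ∈ K, c ∈ B}, tauWord R (K ++ I) '' V,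
    isOpen_biUnion fun K _ => isOpenMap_tauWord hR _ _ hVo, ?_, ?_, ?_, I, hI, ?_⟩
  · rintro b hb _ ⟨u, hu, rfl⟩
    obtain ⟨K, hK, x, hx, rfl⟩ := mem_iUnion₂.1 hu
    exact mem_iUnion₂.2 ⟨b :: K, by simpa [hb] using hK, x, hx, rfl⟩
  · intro b hb b' hb' hbb
    refine eq_empty_of_forall_notMem ?_
    rintro _ ⟨⟨u, hu, rfl⟩, ⟨u', hu', heq⟩⟩
    obtain ⟨K, hK, x, hx, rfl⟩ := mem_iUnion₂.1 hu
    obtain ⟨K', hK', y, hy, rfl⟩ := mem_iUnion₂.1 hu'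
    rcases le_total K.length K'.length with h | h
    · exact hdisj b hb b' hb' hbb K K' hK hK' h x hx y hy heq.symm
    · exact hdisj b' hb' b hb hbb.symm K' K hK' hK h y hy x hx heq
  · intro b hb b' hb' hbb
    refine eq_empty_of_forall_notMem ?_
    rintro _ ⟨⟨u, hu, rfl⟩, ⟨t, ht, heq⟩⟩
    obtain ⟨K, hK, x, hx, rfl⟩ := mem_iUnion₂.1 hu
    obtain ⟨L, hL, hLB, t', ht', rfl⟩ := exists_eq_tauWord hT (K.length + I.length) t ht
    exact hsep b hb b' hb' hbb K L hK hLB hL x hx t' (hTV ht') heq.symm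
  · exact fun y hy => mem_iUnion₂.2 ⟨[], by simp, hy⟩

end Words

/-! ### Self-affine sets and measures -/

section SelfAffine

open Set

variable {d : ℕ} {R : Matrix (Fin d) (Fin d) ℤ} {B : Finset (Fin d → ℤ)}
  {p : (Fin d → ℤ) → ℝ≥0} {μ : Measure (Fin d → ℝ)} {T : Set (Fin d → ℝ)}

theorem isAttractor_iff : IsAttractor R B T ↔
    T.Nonempty ∧ IsCompact T ∧ T = ⋃ b : B, tau R b '' T := by
  rw [IsAttractor, iUnion_subtype]

theorem existsUnique_isAttractor (hR : Expansive R) (hB : B.Nonempty) :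
    ∃! T : Set (Fin d → ℝ), IsAttractor R B T := by
  obtain ⟨K, hK, N, hN, hf⟩ := hR.exists_lipschitzWith_tau
  have := hB.to_subtype
  simp only [isAttractor_iff]
  exact @existsUnique_attractor B (Fin d → ℝ) (fun b => tau R b) K _
    (orbitMetricSpace _ K hN) inferInstance _ _ hK fun b => hf b

theorem isSelfAffineMeasure_iff : IsSelfAffineMeasure R B p μ ↔ IsProbabilityMeasure μ ∧
    ∀ E, MeasurableSet E → μ E = ∑ b : B, (p b : ℝ≥0∞) * μ (tau R b ⁻¹' E) := by
  refine and_congr_right' (forall₂_congr fun E _ => ?_)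
  rw [B.sum_coe_sort fun b => (p b : ℝ≥0∞) * μ (tau R b ⁻¹' E)]

theorem existsUnique_isSelfAffineMeasure (hR : Expansive R) (hB : B.Nonempty)
    (hp : IsWeight B p) : ∃! μ : Measure (Fin d → ℝ), IsSelfAffineMeasure R B p μ := by
  obtain ⟨K, hK, N, hN, hf⟩ := hR.exists_lipschitzWith_tau
  have := hB.to_subtype
  have hp1 : ∑ b : B, p b = 1 := by rw [B.sum_coe_sort]; exact hp.2
  simp only [isSelfAffineMeasure_iff]
  obtain ⟨μ, hμ⟩ := @exists_invariantMeasure B (Fin d → ℝ) (fun b => tau R b) K _ _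
    (fun b => p b) (orbitMetricSpace _ K hN) inferInstance inferInstance _ hK (fun b => hf b) hp1
  refine ⟨μ, hμ, fun ν hν => ?_⟩
  have := hμ.1
  have := hν.1
  exact @invariantMeasure_unique B (Fin d → ℝ) (fun b => tau R b) K _ _ (fun b => p b) ν μ
    (orbitMetricSpace _ K hN) inferInstance inferInstance _ hK (fun b => hf b) hp1 _ _ hν.2 hμ.2

theorem IsSelfAffineMeasure.measure_compl_eq_zero (hR : Expansive R) (hp : IsWeight B p)
    (hT : IsAttractor R B T) (hμ : IsSelfAffineMeasure R B p μ) : μ Tᶜ = 0 := by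
  obtain ⟨K, hK, N, hN, hf⟩ := hR.exists_lipschitzWith_tau
  have hp1 : ∑ b : B, p b = 1 := by rw [B.sum_coe_sort]; exact hp.2
  rw [isSelfAffineMeasure_iff] at hμ
  rw [isAttractor_iff] at hT
  have := hμ.1
  exact @measure_compl_attractor B (Fin d → ℝ) (fun b => tau R b) K _ _ (fun b => p b) μ
    (orbitMetricSpace _ K hN) inferInstance hK (fun b => hf b) hp1 _ hμ.2 T hT.2.1.isClosed hT.1
    hT.2.2.ge

theorem IsAttractor.exists_invariant_neighborhood (hR : Expansive R) (hT : IsAttractor R B T) :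
    ∃ V : Set (Fin d → ℝ), IsOpen V ∧ Bornology.IsBounded V ∧ T ⊆ V ∧
      ∀ b ∈ B, tau R b '' V ⊆ V := by
  obtain ⟨K, hK, N, hN, hf⟩ := hR.exists_lipschitzWith_tau
  obtain ⟨V, hVo, hTV, hV1, hV⟩ := @exists_isOpen_invariant B (Fin d → ℝ) (fun b => tau R b) K
    (orbitMetricSpace _ K hN) hK (fun b => hf b) T (isAttractor_iff.1 hT).2.2.ge
  refine ⟨V, hVo, (hT.2.1.isBounded.thickening (δ := 1)).subset fun x hx => ?_, hTV,
    fun b hb => hV ⟨b, hb⟩⟩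
  obtain ⟨t, ht, hxt⟩ := hV1 x hx
  exact Metric.mem_thickening_iff.2
    ⟨t, ht, (dist_le_orbitMetricSpace_dist _ K hN x t).trans_lt hxt⟩

/-- The sets used in all the separation conditions. Besides the properties of an open set
condition, `U` contains the image of the attractor under some word, and the first level images of
`U` miss those of `T`. -/
theorem IsAttractor.exists_isOSCSet (hR : Expansive R) (hB : SimpleDigitSet R B)
    (hT : IsAttractor R B T) :
    ∃ U : Set (Fin d → ℝ), IsOSCSet R B U ∧
      (∀ b ∈ B, ∀ b' ∈ B, b ≠ b' → tau R b '' U ∩ tau R b' '' T = ∅) ∧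
      ∃ I : List (Fin d → ℤ), (∀ c ∈ I, c ∈ B) ∧ tauWord R I '' T ⊆ U := by
  obtain ⟨V, hVo, hVb, hTV, hV⟩ := hT.exists_invariant_neighborhood hR
  obtain ⟨U, hUo, hU, hUU, hUT, I, hI, hIV⟩ :=
    exists_isOpen_separated hR hB hVo hVb hV hTV hT.2.2.le
  have hIT := (image_mono hTV).trans hIV
  exact ⟨U, ⟨hUo, (hT.1.image _).mono hIT, hUU, iUnion₂_subset hU⟩, hUT, I, hI, hIT⟩

theorem IsAttractor.sosc (hR : Expansive R) (hB : SimpleDigitSet R B) (hT : IsAttractor R B T) :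
    SOSC R B T := by
  obtain ⟨U, hU, -, I, hI, hIU⟩ := hT.exists_isOSCSet hR hB
  obtain ⟨t, ht⟩ := hT.1
  have hTT : ∀ b ∈ B, tau R b '' T ⊆ T := fun b hb => by
    conv_rhs => rw [hT.2.2]
    exact subset_biUnion_of_mem (u := fun b => tau R b '' T) hb
  exact ⟨U, hU, tauWord R I t, hIU (mem_image_of_mem _ ht), mapsTo_tauWord hTT hI ht⟩

/-- In `μ C = ∑ p_b μ (τ_b⁻¹ C)` every term on the right is at most `p_b μ C`, so that none of these
inequalities is strict. -/
theorem IsSelfAffineMeasure.measure_diff_preimage_eq_zero (hp : IsWeight B p)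
    (hμ : IsSelfAffineMeasure R B p μ) {C : Set (Fin d → ℝ)} (hC : MeasurableSet C)
    (hCsub : ∀ b ∈ B, tau R b ⁻¹' C ⊆ C) {b : Fin d → ℤ} (hb : b ∈ B) :
    μ (C \ tau R b ⁻¹' C) = 0 := by
  have := hμ.1
  have hreal : μ.real C = ∑ c ∈ B, (p c : ℝ) * μ.real (tau R c ⁻¹' C) := by
    rw [measureReal_def, hμ.2 C hC, ENNReal.toReal_sum fun c _ => by finiteness]
    simp [measureReal_def]
  have hsum : ∑ c ∈ B, (p c : ℝ) * (μ.real C - μ.real (tau R c ⁻¹' C)) = 0 := by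
    have hp1 : ∑ c ∈ B, (p c : ℝ) = 1 := by exact_mod_cast hp.2
    simp only [mul_sub, Finset.sum_sub_distrib, ← Finset.sum_mul, hp1, one_mul, ← hreal, sub_self]
  have h0 := (Finset.sum_eq_zero_iff_of_nonneg fun c hc =>
    mul_nonneg (p c).2 (sub_nonneg.2 (measureReal_mono (hCsub c hc)))).1 hsum b hb
  have hpb : (p b : ℝ) ≠ 0 := by exact_mod_cast (hp.1 b hb).ne'
  rw [measure_sdiff (hCsub b hb) ((continuous_tau b).measurable hC).nullMeasurableSet
    (by finiteness), tsub_eq_zero_iff_le,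
    ← ENNReal.toReal_le_toReal (by finiteness) (by finiteness)]
  exact (sub_eq_zero.1 ((mul_eq_zero.1 h0).resolve_left hpb)).le

theorem IsSelfAffineMeasure.measure_preimage_eq_zero (hp : IsWeight B p)
    (hμ : IsSelfAffineMeasure R B p μ) {E : Set (Fin d → ℝ)} (hE : MeasurableSet E)
    (hE0 : μ E = 0) {b : Fin d → ℤ} (hb : b ∈ B) : μ (tau R b ⁻¹' E) = 0 := by
  rw [hμ.2 E hE, Finset.sum_eq_zero_iff] at hE0
  exact (mul_eq_zero.1 (hE0 b hb)).resolve_left (by exact_mod_cast (hp.1 b hb).ne')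

theorem IsSelfAffineMeasure.measure_preimage_tauWord_eq_zero (hp : IsWeight B p)
    (hμ : IsSelfAffineMeasure R B p μ) {w : List (Fin d → ℤ)} (hw : ∀ c ∈ w, c ∈ B) :
    ∀ E : Set (Fin d → ℝ), MeasurableSet E → μ E = 0 → μ (tauWord R w ⁻¹' E) = 0 := by
  induction w with
  | nil => exact fun E _ h => h
  | cons b w ih =>
    intro E hE h
    exact ih (fun c hc => hw c (List.mem_cons_of_mem _ hc)) _ ((continuous_tau b).measurable hE)
      (hμ.measure_preimage_eq_zero hp hE h (hw b (by simp)))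

theorem IsSelfAffineMeasure.measure_diff_preimage_tauWord_eq_zero (hp : IsWeight B p)
    (hμ : IsSelfAffineMeasure R B p μ) {C : Set (Fin d → ℝ)} (hC : MeasurableSet C)
    (hCsub : ∀ b ∈ B, tau R b ⁻¹' C ⊆ C) {w : List (Fin d → ℤ)} (hw : ∀ c ∈ w, c ∈ B) :
    μ (C \ tauWord R w ⁻¹' C) = 0 := by
  induction w with
  | nil => simp [tauWord]
  | cons b w ih =>
    have hwB : ∀ c ∈ w, c ∈ B := fun c hc => hw c (List.mem_cons_of_mem _ hc)
    have hb : b ∈ B := hw b (by simp)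
    have h := hμ.measure_preimage_tauWord_eq_zero hp hwB _
      (hC.diff ((continuous_tau b).measurable hC)) (hμ.measure_diff_preimage_eq_zero hp hC hCsub hb)
    refine measure_mono_null ?_ (measure_union_null (ih hwB) h)
    rintro x ⟨hx, hxn⟩
    by_cases hxw : tauWord R w x ∈ C
    · exact .inr ⟨hxw, hxn⟩
    · exact .inl ⟨hx, hxw⟩

/-- The complement `C` of `U` is null: it differs by a null set from `τ_I⁻¹ C`, which misses the
support `T` of `μ` when `τ_I T ⊆ U`. Hence almost every point lies in some `τ_c U`, while a point
common to `τ_b T` and `τ_b' T` lies in none of them. -/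
theorem IsAttractor.noOverlap (hR : Expansive R) (hB : SimpleDigitSet R B) (hT : IsAttractor R B T)
    (hp : IsWeight B p) (hμ : IsSelfAffineMeasure R B p μ) : NoOverlap R B T μ := by
  obtain ⟨U, ⟨hUo, -, -, hU⟩, hUT, I, hI, hIU⟩ := hT.exists_isOSCSet hR hB
  have hUsub : ∀ b ∈ B, tau R b '' U ⊆ U := iUnion₂_subset_iff.1 hU
  have hUm : MeasurableSet Uᶜ := hUo.measurableSet.compl
  have hdiff := hμ.measure_diff_preimage_tauWord_eq_zero hp hUm
    (fun b hb x hx hxU => hx (hUsub b hb (mem_image_of_mem _ hxU))) hI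
  have hUnull : μ Uᶜ = 0 := by
    refine measure_mono_null ?_
      (measure_union_null hdiff (hμ.measure_compl_eq_zero hR hp hT))
    intro x hx
    by_cases hxT : x ∈ T
    · exact .inl ⟨hx, fun h => h (hIU (mem_image_of_mem _ hxT))⟩
    · exact .inr hxT
  have hUnull' : μ (⋃ c ∈ B, tau R c '' U)ᶜ = 0 := by
    have hm : MeasurableSet (⋃ c ∈ B, tau R c '' U)ᶜ :=
      (isOpen_biUnion fun c _ => isOpenMap_tau hR c U hUo).measurableSet.compl
    rw [hμ.2 _ hm, Finset.sum_eq_zero_iff]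
    intro c hc
    refine mul_eq_zero_of_right _ (measure_mono_null ?_ hUnull)
    exact fun x hx hxU => hx (mem_biUnion (t := fun c => tau R c '' U) hc (mem_image_of_mem _ hxU))
  intro b hb b' hb' hbb
  refine measure_mono_null ?_ hUnull'
  rintro x ⟨hxb, hxb'⟩ hxU
  obtain ⟨c, hc, hxc⟩ := mem_iUnion₂.1 hxU
  by_cases hcb : c = b
  · exact (hUT c hc b' hb' (hcb ▸ hbb)).subset ⟨hxc, hxb'⟩
  · exact (hUT c hc b hb hcb).subset ⟨hxc, hxb⟩

end SelfAffine

end AffineIFS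

theorem mainTheorem2 (d : ℕ) (R : Matrix (Fin d) (Fin d) ℤ) (B : Finset (Fin d → ℤ))
    (hR : AffineIFS.Expansive R) (hB : AffineIFS.SimpleDigitSet R B) :
    -- the attractor and the self-affine measures are well defined
    (∃! T : Set (Fin d → ℝ), AffineIFS.IsAttractor R B T) ∧
    (∀ p : (Fin d → ℤ) → ℝ≥0, AffineIFS.IsWeight B p →
      ∃! μ : Measure (Fin d → ℝ), AffineIFS.IsSelfAffineMeasure R B p μ) ∧
    -- the open set condition
    AffineIFS.OSC R B ∧
    -- the strong open set condition
    (∀ T : Set (Fin d → ℝ), AffineIFS.IsAttractor R B T → AffineIFS.SOSC R B T) ∧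
    -- the no-overlap condition
    (∀ T : Set (Fin d → ℝ), AffineIFS.IsAttractor R B T →
      ∀ p : (Fin d → ℤ) → ℝ≥0, AffineIFS.IsWeight B p →
      ∀ μ : Measure (Fin d → ℝ), AffineIFS.IsSelfAffineMeasure R B p μ →
        AffineIFS.NoOverlap R B T μ) := by
  have hex := AffineIFS.existsUnique_isAttractor hR hB.1
  refine ⟨hex, fun p hp => AffineIFS.existsUnique_isSelfAffineMeasure hR hB.1 hp, ?_,
    fun T hT => hT.sosc hR hB, fun T hT p hp μ hμ => hT.noOverlap hR hB hp hμ⟩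
  obtain ⟨T, hT, -⟩ := hex
  obtain ⟨U, hU, -⟩ := hT.sosc hR hB
  exact ⟨U, hU⟩
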